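/- For $N=1,2,\dots$ consider the chain of vehicles $0,1,\dots,N$ with positions $x_k(t)\in\mathbb R$ governed by $$\ddot x_k=u_k+d_k,\qquad u_k=a_2(x_{k+1}-x_k)+b_2(\dot x_{k+1}-\dot x_k)+a_1(x_{k-1}-x_k)+b_1(\dot x_{k-1}-\dot x_k),\qquad 0\le k\le N,$$ where the two terms containing $x_{k+1},\dot x_{k+1}$ are omitted for $k=N$ and the two terms containing $x_{k-1},\dot x_{k-1}$ are omitted for $k=0$, and where $d_k$ are locally integrable disturbances on $\mathbb R$. Put $e_k=x_{k-1}-x_k$ and $d'_k=d_{k-1}-d_k$ for $1\le k\le N$. Responses $e$ are taken from equilibrium, i.e. $e_k(t)\to0$ and $\dot e_k(t)\to0$ as $t\to-\infty$. For a vector signal $z$ write $\|z\|_2=\big(\sum_k\int_{-\infty}^{\infty}|z_k(t)|^2\,dt\big)^{1/2}\in[0,\infty]$. Fix $a,b,\kappa>0$ and, for $\alpha>0$, tune the controller by $$a_1=\tfrac{\kappa}{1+\alpha}a,\quad b_1=\tfrac{\kappa}{1+\alpha}b,\quad a_2=\alpha a_1,\quad b_2=\alpha b_1 .$$ Then there is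 $\bar\alpha\ge 1$ such that for every $\alpha>\bar\alpha$ the following holds. (i) For every $N\ge1$, the undisturbed error dynamics ($d=0$) is asymptotically stable: the state $(e,\dot e)=0$ is Lyapunov stable, and $e_k(t)\to0$, $\dot e_k(t)\to0$ as $t\to+\infty$ for every solution and every $k$. (ii) For every integer $\bar k\ge0$ the family of chains is $(L_2,l_2)$ string stable with respect to disturbances such that $d'_k=0$ for all $k>\bar k$: for every $\epsilon>0$ there is $\delta>0$, independent of $N$, such that for all $N\ge1$ and all such disturbances, $\|d\|_2<\delta$ implies $\|e\|_2<\epsilon$; and likewise for every $\epsilon>0$ there is $\delta>0$, independent of $N$, such that $\|d'\|_2<\delta$ implies $\|e\|_2<\epsilon$. (iii) More precisely, for every integer $\bar k\ge0$ there is a constant $C$, depending on $a,b,\kappa,\alpha,\bar k$ but not on $N$, such that for all $N\ge1$ and all disturbances with $d'_k=0$ for all $k>\bar k$, $$\|e\|_2\le C\,\|d'\|_2\qquad\text{and}\qquad \sum_{k=1}^N\Big(\int_{-\infty}^\infty|e_k(t)|^2dt\Big)^{1/2}\le C\,\|d'\|_2 .$$ -/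

import Mathlib

open Filter Topology MeasureTheory
open scoped ENNReal NNReal

/-- The four gains of the asymmetric bidirectional PD controller: `a₁, b₁` weight the relative
position and velocity with respect to the predecessor, `a₂, b₂` those with respect to the follower. -/
structure PDGains where
  a₁ : ℝ
  b₁ : ℝ
  a₂ : ℝ
  b₂ : ℝ

namespace PDGains

/-- The tuning `p₁ = κ / (1 + α) * (a + b s)` and `p₂ = α * p₁`, where `pᵢ = aᵢ + bᵢ s`. -/
noncomputable def tuned (a b κ α : ℝ) : PDGains where
  a₁ := κ / (1 + α) * a
  b₁ := κ / (1 + α) * b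
  a₂ := α * (κ / (1 + α) * a)
  b₂ := α * (κ / (1 + α) * b)

/-- The control input `u_k` of vehicle `k ∈ {0, …, N}`, from the positions `x` and velocities `v` of
all the vehicles at one instant. The term towards the follower is absent for the last vehicle, and
the term towards the predecessor is absent for the first one. -/
noncomputable def control (g : PDGains) {N : ℕ} (x v : Fin (N + 1) → ℝ) (k : Fin (N + 1)) : ℝ :=
  (if h : (k : ℕ) < N then
      g.a₂ * (x ⟨k + 1, by omega⟩ - x k) + g.b₂ * (v ⟨k + 1, by omega⟩ - v k)
    else 0) +
  (if 0 < (k : ℕ) then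
      g.a₁ * (x ⟨k - 1, by omega⟩ - x k) + g.b₁ * (v ⟨k - 1, by omega⟩ - v k)
    else 0)

end PDGains

/-- Consecutive differences: `gaps z` is the signal `(z_{k-1} - z_k)` for `k = 1, …, N`; the entry
with index `i : Fin N` is the one for `k = i + 1`. It gives the spacing errors `e` from the
positions `x`, and `d'` from the disturbances `d`. -/
def gaps {N : ℕ} (z : Fin (N + 1) → ℝ → ℝ) : Fin N → ℝ → ℝ :=
  fun i t => z i.castSucc t - z i.succ t

/-- `x`, with velocity `v`, is a trajectory of the closed-loop chain `x_k'' = u_k + d_k`,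
`k = 0, …, N`, driven by the locally integrable disturbance `d`: each `x_k` is differentiable with
derivative `v_k`, and `v_k` is locally absolutely continuous with derivative `u_k + d_k` a.e. -/
structure IsTrajectory (g : PDGains) {N : ℕ} (d x v : Fin (N + 1) → ℝ → ℝ) : Prop where
  locallyIntegrable : ∀ k, LocallyIntegrable (d k) volume
  velocity : ∀ k t, HasDerivAt (x k) (v k t) t
  acceleration : ∀ k s t, v k t - v k s =
    ∫ τ in s..t, (g.control (fun j => x j τ) (fun j => v j τ) k + d k τ)

/-- `e` is the response of the spacing errors of the chain with vehicles `0, …, N` to the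
disturbance `d`, starting from equilibrium in the remote past: spacing errors and their derivatives
tend to `0` as `t → -∞` (in particular, this includes all responses with zero initial state at some
time, the disturbance vanishing before). -/
def IsErrorResponse (g : PDGains) (N : ℕ) (d : Fin (N + 1) → ℝ → ℝ) (e : Fin N → ℝ → ℝ) : Prop :=
  ∃ x v : Fin (N + 1) → ℝ → ℝ, IsTrajectory g d x v ∧ e = gaps x ∧
    ∀ i, Tendsto (gaps x i) atBot (𝓝 0) ∧ Tendsto (gaps v i) atBot (𝓝 0)

/-- The spacing-error dynamics of the undisturbed chain with vehicles `0, …, N` is asymptotically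
stable: Lyapunov stable and attractive. -/
def AsymptoticallyStable (g : PDGains) (N : ℕ) : Prop :=
  (∀ ε : ℝ, 0 < ε → ∃ δ : ℝ, 0 < δ ∧ ∀ x v : Fin (N + 1) → ℝ → ℝ, IsTrajectory g 0 x v →
    (∀ i, |gaps x i 0| < δ ∧ |gaps v i 0| < δ) →
    ∀ t, 0 ≤ t → ∀ i, |gaps x i t| < ε ∧ |gaps v i t| < ε) ∧
  ∀ x v : Fin (N + 1) → ℝ → ℝ, IsTrajectory g 0 x v →
    ∀ i, Tendsto (gaps x i) atTop (𝓝 0) ∧ Tendsto (gaps v i) atTop (𝓝 0)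

/-- The `(L₂, l₂)` norm `(∑ₖ ∫ |zₖ(t)|² dt)^(1/2)` of a vector signal on `ℝ`, with values in
`[0, ∞]`. -/
noncomputable def normL2l2 {ι : Type} [Fintype ι] (z : ι → ℝ → ℝ) : ℝ≥0∞ :=
  (∑ k, ∫⁻ t, ‖z k t‖ₑ ^ 2) ^ (1 / 2 : ℝ)

/-- The components of `d'` with index larger than `kbar` (counting from `1`) vanish. -/
def SupportedOnFirst (kbar : ℕ) {N : ℕ} (d' : Fin N → ℝ → ℝ) : Prop :=
  ∀ i : Fin N, kbar < (i : ℕ) + 1 → ∀ᵐ t, d' i t = 0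

/-- `(L₂, l₂)` string stability of a family of networks indexed by `N = 1, 2, …`, where `R N w e`
says that the input `w` of the `N`-th network produces the error vector `e`. -/
def StringStable {ι : ℕ → Type} [∀ N, Fintype (ι N)]
    (R : ∀ N, (ι N → ℝ → ℝ) → (Fin N → ℝ → ℝ) → Prop) : Prop :=
  ∀ ε : ℝ, 0 < ε → ∃ δ : ℝ, 0 < δ ∧ ∀ N, 1 ≤ N → ∀ w e, R N w e →
    normL2l2 w < ENNReal.ofReal δ → normL2l2 e < ENNReal.ofReal ε

/-! Put `p₁ = a₁ + b₁ s`, `p₂ = a₂ + b₂ s`. Subtracting consecutive equations gives `e_k'' = p₁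
e_{k-1} - (p₁ + p₂) e_k + p₂ e_{k+1} + d'_k`, and the missing terms at the two ends of the chain
amount to the Dirichlet conditions `e_0 = e_{N+1} = 0`. Since `p₂ = α p₁`, the weighted errors `F_k
= r ^ k e_k` with `r = √α` satisfy a symmetric system, `F'' = -κ (a T F + b T F') + G`, where `T` is
tridiagonal with diagonal `1` and off-diagonal `-β`, `β = r / (1 + r ^ 2)`
(`weightedGap_tuned_control`). For `r > 1` one has `β < 1 / 2`, so `T ≥ 1 - 2 β > 0` for every `N`
at once.

Such a damped system has a quadratic Lyapunov function with constants independent of `N`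
(`exists_lyapunov_constants`). It yields exponential decay without disturbances, hence (i), and a
uniform `L₂` gain from the weighted `d'` to the weighted `e` (`exists_weighted_gain`).

The weights are undone in `exists_uniform_gain`. On the support of `d'` they are at most `r ^ kbar`;
on the error side they give `‖e_k‖ ≤ const * r ^ (-k)`, and the geometric series bounds even the sum
of the norms. So `αbar = 1` suffices. -/

/-! ### The Dirichlet Toeplitz form of the symmetrized chain -/

/-- The bilinear form of the Dirichlet tridiagonal Toeplitz matrix of size `N` with diagonal `1` and
off-diagonal entries `-β`, applied to the entries `1, …, N` of two sequences vanishing at `0` and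
`N + 1`. -/
noncomputable def chainForm (β : ℝ) (N : ℕ) (F H : ℕ → ℝ) : ℝ :=
  ∑ i ∈ Finset.range N, F (i + 1) * (H (i + 1) - β * (H i + H (i + 2)))

/-- Discrete summation by parts: both sides are one sum over `N + 1` terms, less an end term killed
by a boundary value. -/
lemma sum_mul_shift_eq (N : ℕ) (F H : ℕ → ℝ) (hH0 : H 0 = 0) (hFN : F (N + 1) = 0) :
    ∑ i ∈ Finset.range N, F (i + 1) * H i = ∑ i ∈ Finset.range N, F (i + 2) * H (i + 1) := by
  have h1 := Finset.sum_range_succ (fun i => F (i + 1) * H i) N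
  have h2 := Finset.sum_range_succ' (fun i => F (i + 1) * H i) N
  simp only [hH0, hFN, zero_mul, mul_zero, add_zero] at h1 h2
  rw [← h1, h2]

lemma chainForm_eq (β : ℝ) (N : ℕ) (F H : ℕ → ℝ) (hF0 : F 0 = 0) (hHN : H (N + 1) = 0) :
    chainForm β N F H = ∑ i ∈ Finset.range N, F (i + 1) * H (i + 1)
      - β * (∑ i ∈ Finset.range N, F (i + 1) * H i + ∑ i ∈ Finset.range N, H (i + 1) * F i) := by
  rw [sum_mul_shift_eq N H F hF0 hHN, chainForm, ← Finset.sum_add_distrib, Finset.mul_sum,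
    ← Finset.sum_sub_distrib]
  exact Finset.sum_congr rfl fun i _ => by ring

lemma chainForm_comm (β : ℝ) (N : ℕ) (F H : ℕ → ℝ) (hF0 : F 0 = 0) (hH0 : H 0 = 0)
    (hFN : F (N + 1) = 0) (hHN : H (N + 1) = 0) : chainForm β N F H = chainForm β N H F := by
  rw [chainForm_eq β N F H hF0 hHN, chainForm_eq β N H F hH0 hFN]
  simp only [mul_comm (F (_ + 1)) (H (_ + 1))]
  ring

lemma sum_sq_le_sum_sq_succ (N : ℕ) (F : ℕ → ℝ) (hF0 : F 0 = 0) :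
    ∑ i ∈ Finset.range N, F i ^ 2 ≤ ∑ i ∈ Finset.range N, F (i + 1) ^ 2 := by
  have h1 := Finset.sum_range_succ (fun i => F i ^ 2) N
  have h2 := Finset.sum_range_succ' (fun i => F i ^ 2) N
  simp only [hF0] at h2
  nlinarith [sq_nonneg (F N)]

lemma abs_sum_mul_pred_le (N : ℕ) (F : ℕ → ℝ) (hF0 : F 0 = 0) :
    |∑ i ∈ Finset.range N, F (i + 1) * F i| ≤ ∑ i ∈ Finset.range N, F (i + 1) ^ 2 := by
  have h := sum_sq_le_sum_sq_succ N F hF0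
  have key : ∑ i ∈ Finset.range N, |F (i + 1) * F i| ≤
      (∑ i ∈ Finset.range N, F (i + 1) ^ 2 + ∑ i ∈ Finset.range N, F i ^ 2) / 2 := by
    rw [← Finset.sum_add_distrib, Finset.sum_div]
    refine Finset.sum_le_sum fun i _ => ?_
    rw [abs_le']
    constructor <;> nlinarith [sq_nonneg (F (i + 1) - F i), sq_nonneg (F (i + 1) + F i)]
  exact (Finset.abs_sum_le_sum_abs _ _).trans (by linarith)

/-- The neighbour products are controlled by the arithmetic-geometric mean inequality, so the
spectrum lies in `[1 - 2 β, 1 + 2 β]` whatever the size; for `β < 1 / 2` this is the source of all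
uniformity in `N`. -/
lemma chainForm_self_bounds {β : ℝ} (hβ : 0 ≤ β) (N : ℕ) (F : ℕ → ℝ) (hF0 : F 0 = 0)
    (hFN : F (N + 1) = 0) :
    (1 - 2 * β) * ∑ i ∈ Finset.range N, F (i + 1) ^ 2 ≤ chainForm β N F F ∧
      chainForm β N F F ≤ (1 + 2 * β) * ∑ i ∈ Finset.range N, F (i + 1) ^ 2 := by
  have h := abs_le.1 (abs_sum_mul_pred_le N F hF0)
  rw [chainForm_eq β N F F hF0 hFN]
  simp only [← sq]
  constructor <;> nlinarith

/-! ### A Lyapunov function with size-independent constants -/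

/-- The quadratic Lyapunov function of the symmetrized chain. -/
noncomputable def lyapunov (μ ν β : ℝ) (N : ℕ) (F P : ℕ → ℝ) : ℝ :=
  ∑ i ∈ Finset.range N, (P (i + 1) * P (i + 1) / 2 + μ * (F (i + 1) * P (i + 1))) +
    ν / 2 * chainForm β N F F

/-- The derivative of `lyapunov` along a curve with velocity `P` and acceleration `Q`. -/
noncomputable def lyapunovRate (μ ν β : ℝ) (N : ℕ) (F P Q : ℕ → ℝ) : ℝ :=
  ∑ i ∈ Finset.range N, ((Q (i + 1) * P (i + 1) + P (i + 1) * Q (i + 1)) / 2 +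
      μ * (P (i + 1) * P (i + 1) + F (i + 1) * Q (i + 1))) +
    ν / 2 * (chainForm β N P F + chainForm β N F P)

/-- The energy of the entries `1, …, N`. -/
noncomputable def stateEnergy (N : ℕ) (F P : ℕ → ℝ) : ℝ :=
  ∑ i ∈ Finset.range N, F (i + 1) ^ 2 + ∑ i ∈ Finset.range N, P (i + 1) ^ 2

/-- By symmetry of the form, the coefficient `ν = κ (a + γ b)` is exactly the one that cancels the
mixed terms in `F` and `P`: `κ a` comes from the power `P · Q` and `γ κ b` from `γ F · Q`. -/
lemma lyapunovRate_eq (a b κ γ β : ℝ) (N : ℕ) (F P Q G : ℕ → ℝ) (hF0 : F 0 = 0) (hP0 : P 0 = 0)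
    (hFN : F (N + 1) = 0) (hPN : P (N + 1) = 0)
    (hQ : ∀ i < N, Q (i + 1) = -κ * (a * (F (i + 1) - β * (F i + F (i + 2))) +
      b * (P (i + 1) - β * (P i + P (i + 2)))) + G (i + 1)) :
    lyapunovRate γ (κ * (a + γ * b)) β N F P Q =
      -(κ * b) * chainForm β N P P + γ * ∑ i ∈ Finset.range N, P (i + 1) ^ 2
        - γ * κ * a * chainForm β N F F
        + ∑ i ∈ Finset.range N, (P (i + 1) + γ * F (i + 1)) * G (i + 1) := by
  have hc := chainForm_comm β N F P hF0 hP0 hFN hPN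
  have hPQ (μ : ℝ) : ∑ i ∈ Finset.range N, ((Q (i + 1) * P (i + 1) + P (i + 1) * Q (i + 1)) / 2 +
      μ * (P (i + 1) * P (i + 1) + F (i + 1) * Q (i + 1))) =
      -(κ * a) * chainForm β N P F - κ * b * chainForm β N P P
      + μ * ∑ i ∈ Finset.range N, P (i + 1) ^ 2
      - μ * (κ * a) * chainForm β N F F - μ * (κ * b) * chainForm β N F P
      + ∑ i ∈ Finset.range N, (P (i + 1) + μ * F (i + 1)) * G (i + 1) := by
    simp only [chainForm, Finset.mul_sum, ← Finset.sum_sub_distrib, ← Finset.sum_add_distrib]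
    refine Finset.sum_congr rfl fun i hi => ?_
    rw [hQ i (Finset.mem_range.1 hi)]
    ring
  rw [lyapunovRate, hPQ, hc]
  ring

/-- With `γ = κ b (1 - 2 β) / 2`, the Lyapunov function is equivalent to the energy and dissipates,
with constants that do not depend on the size of the chain. -/
theorem exists_lyapunov_constants {a b κ β : ℝ} (ha : 0 < a) (hb : 0 < b) (hκ : 0 < κ)
    (hβ0 : 0 ≤ β) (hβ : β < 1 / 2) :
    ∃ γ m L c K : ℝ, 0 < m ∧ 0 < L ∧ 0 < c ∧ 0 < K ∧
      ∀ (N : ℕ) (F P : ℕ → ℝ), F 0 = 0 → P 0 = 0 → F (N + 1) = 0 → P (N + 1) = 0 →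
        m * stateEnergy N F P ≤ lyapunov γ (κ * (a + γ * b)) β N F P ∧
        lyapunov γ (κ * (a + γ * b)) β N F P ≤ L * stateEnergy N F P ∧
        ∀ Q G : ℕ → ℝ,
          (∀ i < N, Q (i + 1) = -κ * (a * (F (i + 1) - β * (F i + F (i + 2))) +
            b * (P (i + 1) - β * (P i + P (i + 2)))) + G (i + 1)) →
          lyapunovRate γ (κ * (a + γ * b)) β N F P Q ≤
            -c * stateEnergy N F P + K * ∑ i ∈ Finset.range N, G (i + 1) ^ 2 := by
  obtain ⟨σ, hσ⟩ : ∃ σ, σ = 1 - 2 * β := ⟨_, rfl⟩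
  have hσ0 : 0 < σ := by linarith
  -- This choice gives `κ b σ = 2 γ`: the damping outweighs the indefinite term `γ |P|²` by a factor
  -- of two, and `γ ν / 2`-type terms reproduce exactly the `γ ^ 2 |F|²` lost when completing the
  -- square in the lower bound.
  obtain ⟨γ, hγ⟩ : ∃ γ, γ = κ * b * σ / 2 := ⟨_, rfl⟩
  have hγ0 : 0 < γ := by rw [hγ]; positivity
  refine ⟨γ, min (1 / 4) (κ * a * σ / 2), 1 / 2 + γ / 2 + κ * (a + γ * b),
    min (γ / 2) (γ * κ * a * σ / 2), 1 / (2 * γ) + γ / (2 * (κ * a * σ)), by positivity,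
    by positivity, by positivity, by positivity, fun N F P hF0 hP0 hFN hPN => ?_⟩
  obtain ⟨hFl, hFu⟩ := chainForm_self_bounds hβ0 N F hF0 hFN
  obtain ⟨hPl, -⟩ := chainForm_self_bounds hβ0 N P hP0 hPN
  have hX : 0 ≤ ∑ i ∈ Finset.range N, F (i + 1) ^ 2 := Finset.sum_nonneg fun i _ => sq_nonneg _
  have hY : 0 ≤ ∑ i ∈ Finset.range N, P (i + 1) ^ 2 := Finset.sum_nonneg fun i _ => sq_nonneg _
  rw [← hσ] at hFl hPl
  refine ⟨?_, ?_, fun Q G hQ => ?_⟩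
  · have h1 : 1 / 4 * ∑ i ∈ Finset.range N, P (i + 1) ^ 2
        - γ ^ 2 * ∑ i ∈ Finset.range N, F (i + 1) ^ 2 ≤
        ∑ i ∈ Finset.range N, (P (i + 1) * P (i + 1) / 2 + γ * (F (i + 1) * P (i + 1))) := by
      rw [Finset.mul_sum, Finset.mul_sum, ← Finset.sum_sub_distrib]
      refine Finset.sum_le_sum fun i _ => ?_
      nlinarith [sq_nonneg (P (i + 1) / 2 + γ * F (i + 1))]
    have h2 := mul_le_mul_of_nonneg_left hFl (show 0 ≤ κ * (a + γ * b) / 2 by positivity)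
    have h3 : κ * (a + γ * b) / 2 * (σ * ∑ i ∈ Finset.range N, F (i + 1) ^ 2) =
        κ * a * σ / 2 * ∑ i ∈ Finset.range N, F (i + 1) ^ 2
          + γ ^ 2 * ∑ i ∈ Finset.range N, F (i + 1) ^ 2 := by
      have : γ ^ 2 = κ * γ * b / 2 * σ := by rw [sq]; nth_rewrite 1 [hγ]; ring
      rw [this]; ring
    have h4 := mul_le_mul_of_nonneg_right (min_le_left (1 / 4) (κ * a * σ / 2)) hY
    have h5 := mul_le_mul_of_nonneg_right (min_le_right (1 / 4) (κ * a * σ / 2)) hX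
    rw [lyapunov, stateEnergy, mul_add]
    linarith
  · have h1 : ∑ i ∈ Finset.range N, (P (i + 1) * P (i + 1) / 2 + γ * (F (i + 1) * P (i + 1))) ≤
        (1 / 2 + γ / 2) * ∑ i ∈ Finset.range N, P (i + 1) ^ 2
        + γ / 2 * ∑ i ∈ Finset.range N, F (i + 1) ^ 2 := by
      rw [Finset.mul_sum, Finset.mul_sum, ← Finset.sum_add_distrib]
      refine Finset.sum_le_sum fun i _ => ?_
      nlinarith [mul_nonneg hγ0.le (sq_nonneg (P (i + 1) - F (i + 1)))]
    have h2 : chainForm β N F F ≤ 2 * ∑ i ∈ Finset.range N, F (i + 1) ^ 2 := by nlinarith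
    have h3 := mul_le_mul_of_nonneg_left h2 (show 0 ≤ κ * (a + γ * b) / 2 by positivity)
    have h4 : 0 ≤ κ * (a + γ * b) * ∑ i ∈ Finset.range N, P (i + 1) ^ 2 := by positivity
    rw [lyapunov, stateEnergy]
    nlinarith
  · rw [lyapunovRate_eq a b κ γ β N F P Q G hF0 hP0 hFN hPN hQ]
    have h1 := mul_le_mul_of_nonneg_left hPl (show 0 ≤ κ * b by positivity)
    have h1' : κ * b * (σ * ∑ i ∈ Finset.range N, P (i + 1) ^ 2) =
        2 * γ * ∑ i ∈ Finset.range N, P (i + 1) ^ 2 := by rw [hγ]; ring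
    have h2 := mul_le_mul_of_nonneg_left hFl (show 0 ≤ γ * κ * a by positivity)
    -- Young's inequality, weighted so that the disturbance consumes half of the net dissipation in
    -- `P` and half of that in `F`.
    have h3 : ∑ i ∈ Finset.range N, (P (i + 1) + γ * F (i + 1)) * G (i + 1) ≤
        γ / 2 * ∑ i ∈ Finset.range N, P (i + 1) ^ 2
        + γ * κ * a * σ / 2 * ∑ i ∈ Finset.range N, F (i + 1) ^ 2
        + (1 / (2 * γ) + γ / (2 * (κ * a * σ))) * ∑ i ∈ Finset.range N, G (i + 1) ^ 2 := by
      rw [Finset.mul_sum, Finset.mul_sum, Finset.mul_sum, ← Finset.sum_add_distrib,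
        ← Finset.sum_add_distrib]
      refine Finset.sum_le_sum fun i _ => ?_
      have hρ : 0 < κ * a * σ := by positivity
      have e1 : γ / 2 * P (i + 1) ^ 2 + 1 / (2 * γ) * G (i + 1) ^ 2 - P (i + 1) * G (i + 1) =
          (γ * P (i + 1) - G (i + 1)) ^ 2 / (2 * γ) := by field_simp; ring
      have e2 : γ * (κ * a * σ) / 2 * F (i + 1) ^ 2 + γ / (2 * (κ * a * σ)) * G (i + 1) ^ 2
          - γ * F (i + 1) * G (i + 1) =
          γ * ((κ * a * σ) * F (i + 1) - G (i + 1)) ^ 2 / (2 * (κ * a * σ)) := by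
        field_simp; ring
      have p1 : 0 ≤ (γ * P (i + 1) - G (i + 1)) ^ 2 / (2 * γ) := by positivity
      have p2 : 0 ≤ γ * ((κ * a * σ) * F (i + 1) - G (i + 1)) ^ 2 / (2 * (κ * a * σ)) := by
        positivity
      rw [← e1] at p1
      rw [← e2] at p2
      linarith
    have h4 := mul_le_mul_of_nonneg_right (min_le_left (γ / 2) (γ * κ * a * σ / 2)) hY
    have h5 := mul_le_mul_of_nonneg_right (min_le_right (γ / 2) (γ * κ * a * σ / 2)) hX
    rw [stateEnergy]
    linarith

/-! ### Absolute continuity and regularity of velocities -/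

lemma AbsolutelyContinuousOnInterval.finset_sum {ι : Type*} {s t : ℝ} (S : Finset ι)
    {f : ι → ℝ → ℝ} (hf : ∀ i ∈ S, AbsolutelyContinuousOnInterval (f i) s t) :
    AbsolutelyContinuousOnInterval (fun x => ∑ i ∈ S, f i x) s t := by
  classical
  induction S using Finset.induction_on with
  | empty =>
    simpa using (contDiff_const (c := (0 : ℝ))).contDiffOn.absolutelyContinuousOnInterval
  | insert i S hi ih =>
    simp only [Finset.sum_insert hi]
    exact (hf i (Finset.mem_insert_self i S)).fun_add
      (ih fun j hj => hf j (Finset.mem_insert_of_mem hj))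

/-- Disturbances are merely locally integrable, so the Lyapunov function is differentiable only
almost everywhere; absolute continuity is what allows a differential inequality to be integrated. -/
lemma AbsolutelyContinuousOnInterval.sub_le_integral {W w h : ℝ → ℝ} {s t : ℝ} (hst : s ≤ t)
    (hW : AbsolutelyContinuousOnInterval W s t) (hw : ∀ᵐ τ, HasDerivAt W (w τ) τ)
    (hle : ∀ᵐ τ, w τ ≤ h τ) (hh : IntervalIntegrable h volume s t) :
    W t - W s ≤ ∫ τ in s..t, h τ := by
  rw [← hW.integral_deriv_eq_sub]
  refine intervalIntegral.integral_mono_ae hst hW.intervalIntegrable_deriv hh ?_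
  filter_upwards [hw, hle] with τ h1 h2
  rwa [h1.deriv]

/-- A function that is a derivative everywhere and satisfies `v t - v s = ∫ f` between any two points
is continuous, even without assuming that `f` is integrable: where it is not, `v` is constant. -/
lemma continuous_of_hasDerivAt_of_sub_eq_integral {x v f : ℝ → ℝ}
    (hx : ∀ t, HasDerivAt x (v t) t) (hv : ∀ s t, v t - v s = ∫ τ in s..t, f τ) :
    Continuous v := by
  by_cases hf : LocallyIntegrable f volume
  · have hi : ∀ s t, IntervalIntegrable f volume s t := fun s t =>
      (hf.integrableOn_isCompact isCompact_uIcc).intervalIntegrable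
    have : v = fun t => v 0 + ∫ τ in (0 : ℝ)..t, f τ := by
      funext t; rw [← hv 0 t]; ring
    rw [this]
    exact continuous_const.add (intervalIntegral.continuous_primitive hi 0)
  · obtain ⟨p, hp⟩ : ∃ p, ¬ IntegrableAtFilter f (𝓝 p) volume := by
      simpa [LocallyIntegrable] using hf
    -- The integral across a point of non-integrability takes the default value `0`.
    have hjump : ∀ s t, s < p → p < t → v s = v t := by
      intro s t hs ht
      have hn : ¬ IntervalIntegrable f volume s t := fun h =>
        hp ⟨Set.Ioc s t, Ioc_mem_nhds hs ht, h.1⟩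
      have := hv s t
      rw [intervalIntegral.integral_undef hn] at this
      linarith
    have hoff : ∀ t, t ≠ p → v t = v (p + 1) := by
      intro t ht
      rcases lt_or_gt_of_ne ht with h | h
      · exact hjump t (p + 1) h (by linarith)
      · rw [← hjump (p - 1) t (by linarith) h, ← hjump (p - 1) (p + 1) (by linarith) (by linarith)]
    -- Away from `p` the derivative of `x` is constant, and `x` is continuous at `p`; hence the
    -- derivative at `p` has the same value.
    have hat : HasDerivAt x (v (p + 1)) p :=
      hasDerivAt_of_hasDerivAt_of_ne (g := fun _ => v (p + 1))
        (fun t ht => by simpa only [hoff t ht] using hx t) (hx p).continuousAt continuousAt_const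
    have hall : v = fun _ => v (p + 1) := by
      funext t
      by_cases h : t = p
      · rw [h]; exact (hx p).unique hat
      · exact hoff t h
    rw [hall]
    exact continuous_const

/-! ### Spacing-error coordinates and symmetrization -/

/-- The index `k`, replaced by `N` when it exceeds `N`. -/
def clampIndex (N k : ℕ) : Fin (N + 1) := ⟨min k N, by omega⟩

/-- The spacing `z (k - 1) - z k`, continued by `0` to `k = 0` and `k > N`. -/
def clampGap {N : ℕ} (z : Fin (N + 1) → ℝ) (k : ℕ) : ℝ :=
  z (clampIndex N (k - 1)) - z (clampIndex N k)

lemma clampIndex_val {N : ℕ} (k : Fin (N + 1)) : clampIndex N k = k :=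
  Fin.ext (min_eq_left (by omega))

lemma clampGap_zero {N : ℕ} (z : Fin (N + 1) → ℝ) : clampGap z 0 = 0 := by simp [clampGap]

lemma clampGap_last_succ {N : ℕ} (z : Fin (N + 1) → ℝ) : clampGap z (N + 1) = 0 := by
  simp [clampGap, clampIndex]

lemma clampGap_eq_gaps {N : ℕ} (z : Fin (N + 1) → ℝ → ℝ) (i : Fin N) (t : ℝ) :
    clampGap (fun j => z j t) (i + 1) = gaps z i t := by
  have h1 : clampIndex N (i : ℕ) = i.castSucc := Fin.ext (min_eq_left i.2.le)
  have h2 : clampIndex N ((i : ℕ) + 1) = i.succ := Fin.ext (min_eq_left i.2)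
  simp [clampGap, gaps, h1, h2]

namespace PDGains

/-- The clamped gaps vanish at `0` and `N + 1`, so the two end vehicles need no separate formula. -/
lemma control_eq (g : PDGains) {N : ℕ} (x v : Fin (N + 1) → ℝ) (k : Fin (N + 1)) :
    g.control x v k =
      g.a₁ * clampGap x k + g.b₁ * clampGap v k
        - (g.a₂ * clampGap x (k + 1) + g.b₂ * clampGap v (k + 1)) := by
  have h0 : clampIndex N (k : ℕ) = k := clampIndex_val k
  rw [control]
  simp only [clampGap, add_tsub_cancel_right, h0]
  have hA : (if h : (k : ℕ) < N then
      g.a₂ * (x ⟨k + 1, by omega⟩ - x k) + g.b₂ * (v ⟨k + 1, by omega⟩ - v k)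
    else 0) = -(g.a₂ * (x k - x (clampIndex N (k + 1))) +
      g.b₂ * (v k - v (clampIndex N (k + 1)))) := by
    split_ifs with h
    · have : clampIndex N ((k : ℕ) + 1) = ⟨k + 1, by omega⟩ := Fin.ext (min_eq_left h)
      rw [this]; ring
    · have : clampIndex N ((k : ℕ) + 1) = k := Fin.ext (by simp [clampIndex]; omega)
      rw [this]; ring
  have hB : (if 0 < (k : ℕ) then
      g.a₁ * (x ⟨k - 1, by omega⟩ - x k) + g.b₁ * (v ⟨k - 1, by omega⟩ - v k)
    else 0) = g.a₁ * (x (clampIndex N (k - 1)) - x k) +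
      g.b₁ * (v (clampIndex N (k - 1)) - v k) := by
    have : clampIndex N ((k : ℕ) - 1) = ⟨k - 1, by omega⟩ := Fin.ext (min_eq_left (by omega))
    split_ifs with h
    · rw [this]
    · have h' : clampIndex N ((k : ℕ) - 1) = k := Fin.ext (by simp [clampIndex]; omega)
      rw [h']; ring
  rw [hA, hB]; ring

end PDGains

/-- The spacings weighted by `r ^ k`; for `r = √α` this symmetrizes the chain. -/
def weightedGap (r : ℝ) {N : ℕ} (z : Fin (N + 1) → ℝ) (k : ℕ) : ℝ := r ^ k * clampGap z k

lemma weightedGap_zero (r : ℝ) {N : ℕ} (z : Fin (N + 1) → ℝ) : weightedGap r z 0 = 0 := by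
  simp [weightedGap, clampGap_zero]

lemma weightedGap_last_succ (r : ℝ) {N : ℕ} (z : Fin (N + 1) → ℝ) :
    weightedGap r z (N + 1) = 0 := by
  simp [weightedGap, clampGap_last_succ]

lemma weightedGap_add (r : ℝ) {N : ℕ} (y z : Fin (N + 1) → ℝ) (k : ℕ) :
    weightedGap r (fun j => y j + z j) k = weightedGap r y k + weightedGap r z k := by
  simp only [weightedGap, clampGap]; ring

/-- The predecessor term picks up a factor `r` from the weights, the follower term `r⁻¹`; multiplied
by the gain ratio `r ^ 2`, the latter also becomes `r`, so both couplings are equal. -/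
lemma weightedGap_tuned_control (a b κ : ℝ) {r : ℝ} (hr : 0 < r) {N : ℕ} (x v : Fin (N + 1) → ℝ)
    {i : ℕ} (hi : i < N) :
    weightedGap r (fun k => (PDGains.tuned a b κ (r ^ 2)).control x v k) (i + 1) =
      -κ * (a * (weightedGap r x (i + 1) -
          r / (1 + r ^ 2) * (weightedGap r x i + weightedGap r x (i + 2))) +
        b * (weightedGap r v (i + 1) -
          r / (1 + r ^ 2) * (weightedGap r v i + weightedGap r v (i + 2)))) := by
  have h0 : ((clampIndex N i : Fin (N + 1)) : ℕ) = i := min_eq_left hi.le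
  have h1 : ((clampIndex N (i + 1) : Fin (N + 1)) : ℕ) = i + 1 := min_eq_left hi
  have hr2 : 1 + r ^ 2 ≠ 0 := by positivity
  rw [weightedGap, clampGap]
  simp only [PDGains.control_eq, add_tsub_cancel_right, h0, h1, weightedGap, PDGains.tuned]
  field_simp
  ring

/-! ### Regularity along trajectories -/

section Trajectory

variable {g : PDGains} {N : ℕ} {d x v : Fin (N + 1) → ℝ → ℝ}

lemma IsTrajectory.continuous_position (h : IsTrajectory g d x v) (k : Fin (N + 1)) :
    Continuous (x k) :=
  continuous_iff_continuousAt.2 fun t => (h.velocity k t).continuousAt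

lemma IsTrajectory.continuous_velocity (h : IsTrajectory g d x v) (k : Fin (N + 1)) :
    Continuous (v k) :=
  continuous_of_hasDerivAt_of_sub_eq_integral (h.velocity k) (h.acceleration k)

lemma IsTrajectory.locallyIntegrable_acceleration (h : IsTrajectory g d x v) (k : Fin (N + 1)) :
    LocallyIntegrable (fun τ => g.control (fun j => x j τ) (fun j => v j τ) k + d k τ) volume := by
  have hc : Continuous fun τ => g.control (fun j => x j τ) (fun j => v j τ) k := by
    have hx := h.continuous_position
    have hv := h.continuous_velocity
    simp only [PDGains.control_eq, clampGap]
    fun_prop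
  exact hc.locallyIntegrable.add (h.locallyIntegrable k)

lemma IsTrajectory.ae_hasDerivAt_velocity (h : IsTrajectory g d x v) :
    ∀ᵐ t, ∀ k, HasDerivAt (v k)
      (g.control (fun j => x j t) (fun j => v j t) k + d k t) t := by
  refine ae_all_iff.2 fun k => ?_
  filter_upwards [LocallyIntegrable.ae_hasDerivAt_integral (h.locallyIntegrable_acceleration k)]
    with t ht
  have := (ht 0).const_add (v k 0)
  refine this.congr_of_eventuallyEq (Eventually.of_forall fun s => ?_)
  change v k s = v k 0 + _
  rw [← h.acceleration k 0 s]; ring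

lemma IsTrajectory.absolutelyContinuous_velocity (h : IsTrajectory g d x v) (k : Fin (N + 1))
    (s t : ℝ) : AbsolutelyContinuousOnInterval (v k) s t := by
  have hi : IntervalIntegrable
      (fun τ => g.control (fun j => x j τ) (fun j => v j τ) k + d k τ) volume s t :=
    ((h.locallyIntegrable_acceleration k).integrableOn_isCompact isCompact_uIcc).intervalIntegrable
  have hE : v k = fun t => v k s + ∫ τ in s..t,
      (g.control (fun j => x j τ) (fun j => v j τ) k + d k τ) := by
    funext t; rw [← h.acceleration k s t]; ring
  rw [hE]
  exact ((contDiff_const (c := v k s)).contDiffOn.absolutelyContinuousOnInterval).fun_add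
    (hi.absolutelyContinuousOnInterval_intervalIntegral (by simp))

lemma IsTrajectory.absolutelyContinuous_position (h : IsTrajectory g d x v) (k : Fin (N + 1))
    (s t : ℝ) : AbsolutelyContinuousOnInterval (x k) s t := by
  refine ContDiffOn.absolutelyContinuousOnInterval (ContDiff.contDiffOn ?_)
  rw [contDiff_one_iff_deriv]
  refine ⟨fun t => (h.velocity k t).differentiableAt, ?_⟩
  rw [show deriv (x k) = v k from funext fun t => (h.velocity k t).deriv]
  exact h.continuous_velocity k

end Trajectory

/-! ### Differentiating the Lyapunov function along a trajectory -/

lemma AbsolutelyContinuousOnInterval.weightedGap {N : ℕ} {z : Fin (N + 1) → ℝ → ℝ} {s t : ℝ}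
    (h : ∀ k, AbsolutelyContinuousOnInterval (z k) s t) (r : ℝ) (k : ℕ) :
    AbsolutelyContinuousOnInterval (fun τ => weightedGap r (fun j => z j τ) k) s t :=
  ((h _).fun_sub (h _)).const_mul _

lemma HasDerivAt.weightedGap {N : ℕ} {z : Fin (N + 1) → ℝ → ℝ} {z' : Fin (N + 1) → ℝ} {t : ℝ}
    (h : ∀ k, HasDerivAt (z k) (z' k) t) (r : ℝ) (k : ℕ) :
    HasDerivAt (fun τ => weightedGap r (fun j => z j τ) k) (weightedGap r z' k) t :=
  ((h _).sub (h _)).const_mul _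

lemma hasDerivAt_chainForm (β : ℝ) (N : ℕ) {F H : ℕ → ℝ → ℝ} {F' H' : ℕ → ℝ} {t : ℝ}
    (hF : ∀ k, HasDerivAt (F k) (F' k) t) (hH : ∀ k, HasDerivAt (H k) (H' k) t) :
    HasDerivAt (fun τ => chainForm β N (fun k => F k τ) (fun k => H k τ))
      (chainForm β N F' (fun k => H k t) + chainForm β N (fun k => F k t) H') t := by
  rw [chainForm, chainForm, ← Finset.sum_add_distrib]
  exact HasDerivAt.fun_sum fun i _ =>
    (hF _).fun_mul ((hH _).fun_sub (((hH _).fun_add (hH _)).const_mul β))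

lemma hasDerivAt_lyapunov (μ ν β : ℝ) (N : ℕ) {F P : ℕ → ℝ → ℝ} {Q : ℕ → ℝ} {t : ℝ}
    (hF : ∀ k, HasDerivAt (F k) (P k t) t) (hP : ∀ k, HasDerivAt (P k) (Q k) t) :
    HasDerivAt (fun τ => lyapunov μ ν β N (fun k => F k τ) (fun k => P k τ))
      (lyapunovRate μ ν β N (fun k => F k t) (fun k => P k t) Q) t := by
  refine HasDerivAt.fun_add (HasDerivAt.fun_sum fun i _ => ?_)
    ((hasDerivAt_chainForm β N hF hF).const_mul _)
  exact (((hP _).fun_mul (hP _)).div_const 2).fun_add (((hF _).fun_mul (hP _)).const_mul μ)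

lemma AbsolutelyContinuousOnInterval.lyapunov (μ ν β : ℝ) (N : ℕ) {F P : ℕ → ℝ → ℝ} {s t : ℝ}
    (hF : ∀ k, AbsolutelyContinuousOnInterval (F k) s t)
    (hP : ∀ k, AbsolutelyContinuousOnInterval (P k) s t) :
    AbsolutelyContinuousOnInterval
      (fun τ => lyapunov μ ν β N (fun k => F k τ) (fun k => P k τ)) s t := by
  refine (AbsolutelyContinuousOnInterval.finset_sum _ fun i _ => ?_).fun_add
    ((AbsolutelyContinuousOnInterval.finset_sum _ fun i _ => ?_).const_mul _)
  · simp only [div_eq_inv_mul]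
    exact (((hP _).fun_mul (hP _)).const_mul _).fun_add (((hF _).fun_mul (hP _)).const_mul μ)
  · exact (hF _).fun_mul ((hF _).fun_sub (((hF _).fun_add (hF _)).const_mul β))

/-! ### The weighted energy and its dissipation -/

/-- The energy of the weighted spacing errors of a configuration. -/
noncomputable def gapEnergy (r : ℝ) {N : ℕ} (x v : Fin (N + 1) → ℝ) : ℝ :=
  stateEnergy N (weightedGap r x) (weightedGap r v)

lemma gapEnergy_nonneg (r : ℝ) {N : ℕ} (x v : Fin (N + 1) → ℝ) : 0 ≤ gapEnergy r x v :=
  add_nonneg (Finset.sum_nonneg fun _ _ => sq_nonneg _) (Finset.sum_nonneg fun _ _ => sq_nonneg _)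

lemma weightedGap_eq_gaps (r : ℝ) {N : ℕ} (z : Fin (N + 1) → ℝ → ℝ) (i : Fin N) (t : ℝ) :
    weightedGap r (fun j => z j t) (i + 1) = r ^ ((i : ℕ) + 1) * gaps z i t := by
  rw [weightedGap, clampGap_eq_gaps]

lemma gapEnergy_eq (r : ℝ) {N : ℕ} (x v : Fin (N + 1) → ℝ → ℝ) (t : ℝ) :
    gapEnergy r (fun j => x j t) (fun j => v j t) =
      ∑ i : Fin N, (r ^ ((i : ℕ) + 1) * gaps x i t) ^ 2 +
        ∑ i : Fin N, (r ^ ((i : ℕ) + 1) * gaps v i t) ^ 2 := by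
  simp only [gapEnergy, stateEnergy, Finset.sum_range, weightedGap_eq_gaps]

lemma tendsto_gapEnergy (r : ℝ) {N : ℕ} {x v : Fin (N + 1) → ℝ → ℝ} {l : Filter ℝ}
    (h : ∀ i, Tendsto (gaps x i) l (𝓝 0) ∧ Tendsto (gaps v i) l (𝓝 0)) :
    Tendsto (fun t => gapEnergy r (fun j => x j t) (fun j => v j t)) l (𝓝 0) := by
  simp only [gapEnergy_eq]
  have hz : ∀ z : Fin (N + 1) → ℝ → ℝ, (∀ i, Tendsto (gaps z i) l (𝓝 0)) →
      Tendsto (fun t => ∑ i : Fin N, (r ^ ((i : ℕ) + 1) * gaps z i t) ^ 2) l (𝓝 0) := by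
    intro z hz
    have := tendsto_finsetSum (Finset.univ : Finset (Fin N))
      fun i _ => ((hz i).const_mul (r ^ ((i : ℕ) + 1))).pow 2
    simpa using this
  simpa using (hz x fun i => (h i).1).add (hz v fun i => (h i).2)

lemma sq_gaps_le_gapEnergy {r : ℝ} (hr : 1 ≤ r) {N : ℕ} (x v : Fin (N + 1) → ℝ → ℝ) (t : ℝ)
    (i : Fin N) :
    gaps x i t ^ 2 ≤ gapEnergy r (fun j => x j t) (fun j => v j t) ∧
      gaps v i t ^ 2 ≤ gapEnergy r (fun j => x j t) (fun j => v j t) := by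
  rw [gapEnergy_eq]
  have hz : ∀ z : Fin (N + 1) → ℝ → ℝ,
      gaps z i t ^ 2 ≤ ∑ i : Fin N, (r ^ ((i : ℕ) + 1) * gaps z i t) ^ 2 := by
    intro z
    refine le_trans ?_ (Finset.single_le_sum
      (f := fun i : Fin N => (r ^ ((i : ℕ) + 1) * gaps z i t) ^ 2)
      (fun _ _ => sq_nonneg _) (Finset.mem_univ i))
    have h1 : 1 ≤ (r ^ ((i : ℕ) + 1)) ^ 2 := one_le_pow₀ (one_le_pow₀ hr)
    rw [mul_pow]
    nlinarith [sq_nonneg (gaps z i t)]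
  have hp : ∀ z : Fin (N + 1) → ℝ → ℝ,
      0 ≤ ∑ i : Fin N, (r ^ ((i : ℕ) + 1) * gaps z i t) ^ 2 := fun z =>
    Finset.sum_nonneg fun _ _ => sq_nonneg _
  exact ⟨by linarith [hz x, hp v], by linarith [hz v, hp x]⟩

/-- The factor growing with `N` is harmless: it enters only the Lyapunov stability of a chain of
fixed length. -/
lemma gapEnergy_le {r : ℝ} (hr : 1 ≤ r) {N : ℕ} (x v : Fin (N + 1) → ℝ → ℝ) (t : ℝ) {δ : ℝ}
    (h : ∀ i, |gaps x i t| < δ ∧ |gaps v i t| < δ) :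
    gapEnergy r (fun j => x j t) (fun j => v j t) ≤ 2 * N * (r ^ N) ^ 2 * δ ^ 2 := by
  rw [gapEnergy_eq]
  have hz : ∀ z : Fin (N + 1) → ℝ → ℝ, (∀ i, |gaps z i t| < δ) →
      ∑ i : Fin N, (r ^ ((i : ℕ) + 1) * gaps z i t) ^ 2 ≤ N * ((r ^ N) ^ 2 * δ ^ 2) := by
    intro z hz
    refine (Finset.sum_le_card_nsmul _ _ ((r ^ N) ^ 2 * δ ^ 2) fun i _ => ?_).trans (by simp)
    have h1 : r ^ ((i : ℕ) + 1) ≤ r ^ N := pow_le_pow_right₀ hr i.2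
    have h2 : gaps z i t ^ 2 ≤ δ ^ 2 := sq_le_sq' (by linarith [(abs_lt.1 (hz i)).1])
      (abs_lt.1 (hz i)).2.le
    rw [mul_pow]
    gcongr
  linarith [hz x fun i => (h i).1, hz v fun i => (h i).2]

lemma IsTrajectory.continuous_gapEnergy {g : PDGains} {N : ℕ} {d x v : Fin (N + 1) → ℝ → ℝ}
    (h : IsTrajectory g d x v) (r : ℝ) :
    Continuous fun t => gapEnergy r (fun j => x j t) (fun j => v j t) := by
  have hx := h.continuous_position
  have hv := h.continuous_velocity
  simp only [gapEnergy, stateEnergy, weightedGap, clampGap]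
  fun_prop

/-- Equivalent to `(r - 1) ^ 2 > 0`; the spectral gap closes precisely in the symmetric case `r =
1`. -/
lemma div_one_add_sq_lt_half {r : ℝ} (hr : 1 < r) : r / (1 + r ^ 2) < 1 / 2 := by
  rw [div_lt_div_iff₀ (by positivity) (by norm_num)]
  nlinarith [sq_pos_of_pos (sub_pos.2 hr)]

/-- Existence of a uniform Lyapunov function along the trajectories of the chain. -/
theorem exists_lyapunov_trajectory {a b κ r : ℝ} (ha : 0 < a) (hb : 0 < b) (hκ : 0 < κ)
    (hr : 1 < r) :
    ∃ m L c K : ℝ, 0 < m ∧ 0 < L ∧ 0 < c ∧ 0 < K ∧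
      ∀ (N : ℕ) (d x v : Fin (N + 1) → ℝ → ℝ),
        IsTrajectory (PDGains.tuned a b κ (r ^ 2)) d x v →
        ∃ V V' : ℝ → ℝ, (∀ s t, AbsolutelyContinuousOnInterval V s t) ∧
          (∀ t, m * gapEnergy r (fun j => x j t) (fun j => v j t) ≤ V t) ∧
          (∀ t, V t ≤ L * gapEnergy r (fun j => x j t) (fun j => v j t)) ∧
          (∀ᵐ t, HasDerivAt V (V' t) t) ∧
          ∀ t, V' t ≤ -c * gapEnergy r (fun j => x j t) (fun j => v j t) +
            K * ∑ i ∈ Finset.range N, weightedGap r (fun j => d j t) (i + 1) ^ 2 := by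
  obtain ⟨γ, m, L, c, K, hm, hL, hc, hK, H⟩ := exists_lyapunov_constants ha hb hκ
    (show 0 ≤ r / (1 + r ^ 2) by positivity) (div_one_add_sq_lt_half hr)
  refine ⟨m, L, c, K, hm, hL, hc, hK, fun N d x v h => ?_⟩
  have H' := fun t => H N (weightedGap r fun j => x j t) (weightedGap r fun j => v j t)
    (weightedGap_zero r _) (weightedGap_zero r _) (weightedGap_last_succ r _)
    (weightedGap_last_succ r _)
  refine ⟨fun t => lyapunov γ (κ * (a + γ * b)) (r / (1 + r ^ 2)) N
      (weightedGap r fun j => x j t) (weightedGap r fun j => v j t),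
    fun t => lyapunovRate γ (κ * (a + γ * b)) (r / (1 + r ^ 2)) N
      (weightedGap r fun j => x j t) (weightedGap r fun j => v j t)
      (weightedGap r fun k => (PDGains.tuned a b κ (r ^ 2)).control
        (fun j => x j t) (fun j => v j t) k + d k t),
    fun s t => ?_, fun t => (H' t).1, fun t => (H' t).2.1, ?_, fun t => ?_⟩
  · exact AbsolutelyContinuousOnInterval.lyapunov _ _ _ N
      (AbsolutelyContinuousOnInterval.weightedGap
        (fun k => h.absolutelyContinuous_position k s t) r)
      (AbsolutelyContinuousOnInterval.weightedGap
        (fun k => h.absolutelyContinuous_velocity k s t) r)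
  · filter_upwards [h.ae_hasDerivAt_velocity] with t ht
    exact hasDerivAt_lyapunov _ _ _ N
      (HasDerivAt.weightedGap (fun k => h.velocity k t) r) (HasDerivAt.weightedGap ht r)
  · refine (H' t).2.2 _ (weightedGap r fun k => d k t) fun i hi => ?_
    rw [weightedGap_add, weightedGap_tuned_control a b κ (by linarith) _ _ hi]

/-! ### Asymptotic stability without disturbances -/

/-- Exponential decay of the energy of undisturbed trajectories. -/
theorem exists_gapEnergy_decay {a b κ r : ℝ} (ha : 0 < a) (hb : 0 < b) (hκ : 0 < κ)
    (hr : 1 < r) :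
    ∃ A ρ : ℝ, 0 < A ∧ 0 < ρ ∧ ∀ (N : ℕ) (x v : Fin (N + 1) → ℝ → ℝ),
      IsTrajectory (PDGains.tuned a b κ (r ^ 2)) 0 x v → ∀ t, 0 ≤ t →
        gapEnergy r (fun j => x j t) (fun j => v j t) ≤
          A * Real.exp (-ρ * t) * gapEnergy r (fun j => x j 0) (fun j => v j 0) := by
  obtain ⟨m, L, c, K, hm, hL, hc, hK, H⟩ := exists_lyapunov_trajectory ha hb hκ hr
  refine ⟨L / m, c / L, by positivity, by positivity, fun N x v h t ht => ?_⟩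
  obtain ⟨V, V', hac, hlo, hup, hder, hrate⟩ := H N _ x v h
  have hexp : ∀ τ, HasDerivAt (fun τ => Real.exp (c / L * τ))
      (Real.exp (c / L * τ) * (c / L)) τ := fun τ => by
    simpa using ((hasDerivAt_id τ).const_mul (c / L)).exp
  have hWac : AbsolutelyContinuousOnInterval (fun τ => Real.exp (c / L * τ) * V τ) 0 t :=
    AbsolutelyContinuousOnInterval.fun_mul
      (ContDiff.contDiffOn (by fun_prop)).absolutelyContinuousOnInterval (hac 0 t)
  -- Grönwall with integrating factor: `V' ≤ -c E ≤ -(c / L) V`, so `exp (c t / L) V` does not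
  -- increase.
  have hW := hWac.sub_le_integral (h := fun _ => 0) ht
    (w := fun τ => Real.exp (c / L * τ) * (c / L) * V τ + Real.exp (c / L * τ) * V' τ)
    (by filter_upwards [hder] with τ hτ using (hexp τ).fun_mul hτ)
    (Eventually.of_forall fun τ => by
      have h1 := hrate τ
      simp only [weightedGap, clampGap, Pi.zero_apply, sub_self, mul_zero, ne_eq,
        OfNat.ofNat_ne_zero, not_false_eq_true, zero_pow, Finset.sum_const_zero, add_zero] at h1
      have h2 := mul_le_mul_of_nonneg_left (hup τ) (show 0 ≤ c / L by positivity)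
      have h3 : c / L * (L * gapEnergy r (fun j => x j τ) (fun j => v j τ)) =
        c * gapEnergy r (fun j => x j τ) (fun j => v j τ) := by field_simp
      have h4 : c / L * V τ + V' τ ≤ 0 := by linarith
      have h5 := mul_nonpos_of_nonneg_of_nonpos (Real.exp_pos (c / L * τ)).le h4
      linarith)
    intervalIntegrable_const
  simp only [intervalIntegral.integral_zero, mul_zero, Real.exp_zero, one_mul] at hW
  have h1 : Real.exp (c / L * t) * (m * gapEnergy r (fun j => x j t) (fun j => v j t)) ≤
      L * gapEnergy r (fun j => x j 0) (fun j => v j 0) :=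
    (mul_le_mul_of_nonneg_left (hlo t) (Real.exp_pos _).le).trans (by linarith [hup 0])
  have h2 : Real.exp (-(c / L) * t) * Real.exp (c / L * t) = 1 := by
    rw [← Real.exp_add]; simp
  calc gapEnergy r (fun j => x j t) (fun j => v j t)
      = Real.exp (-(c / L) * t) / m *
        (Real.exp (c / L * t) * (m * gapEnergy r (fun j => x j t) (fun j => v j t))) := by
          rw [show ∀ p q E : ℝ, p / m * (q * (m * E)) = p * q * (m / m) * E from
            fun p q E => by ring, h2, div_self hm.ne', one_mul, one_mul]
    _ ≤ Real.exp (-(c / L) * t) / m * (L * gapEnergy r (fun j => x j 0) (fun j => v j 0)) := by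
          gcongr
    _ = _ := by ring

/-- The undisturbed error dynamics is asymptotically stable. -/
theorem asymptoticallyStable_tuned {a b κ r : ℝ} (ha : 0 < a) (hb : 0 < b) (hκ : 0 < κ)
    (hr : 1 < r) (N : ℕ) : AsymptoticallyStable (PDGains.tuned a b κ (r ^ 2)) N := by
  obtain ⟨A, ρ, hA, hρ, H⟩ := exists_gapEnergy_decay ha hb hκ hr
  refine ⟨fun ε hε => ?_, fun x v h i => ?_⟩
  · obtain ⟨M, hM⟩ : ∃ M, M = A * (2 * N * (r ^ N) ^ 2) := ⟨_, rfl⟩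
    have hM0 : 0 ≤ M := by rw [hM]; positivity
    refine ⟨ε / (M + 1), by positivity, fun x v h h0 t ht i => ?_⟩
    have hlt : gapEnergy r (fun j => x j t) (fun j => v j t) < ε ^ 2 := by
      calc gapEnergy r (fun j => x j t) (fun j => v j t)
          ≤ A * Real.exp (-ρ * t) * gapEnergy r (fun j => x j 0) (fun j => v j 0) := H N x v h t ht
        _ ≤ A * 1 * (2 * N * (r ^ N) ^ 2 * (ε / (M + 1)) ^ 2) := by
            have h1 : Real.exp (-ρ * t) ≤ 1 := Real.exp_le_one_iff.2 (by nlinarith)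
            have h2 := gapEnergy_le hr.le x v 0 h0
            have h3 := gapEnergy_nonneg r (fun j => x j 0) (fun j => v j 0)
            gcongr
        _ = M * (ε / (M + 1)) ^ 2 := by rw [hM]; ring
        _ < ε ^ 2 := by
            rw [div_pow, ← mul_div_assoc, div_lt_iff₀ (by positivity)]
            nlinarith [sq_pos_of_pos hε, mul_nonneg (sq_nonneg ε) hM0,
              mul_nonneg (sq_nonneg ε) (sq_nonneg M)]
    obtain ⟨h1, h2⟩ := sq_gaps_le_gapEnergy hr.le x v t i
    exact ⟨abs_lt_of_sq_lt_sq (h1.trans_lt hlt) hε.le, abs_lt_of_sq_lt_sq (h2.trans_lt hlt) hε.le⟩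
  · have hb0 : Tendsto (fun t => A * Real.exp (-ρ * t) *
        gapEnergy r (fun j => x j 0) (fun j => v j 0)) atTop (𝓝 0) := by
      have h1 : Tendsto (fun t : ℝ => Real.exp (-ρ * t)) atTop (𝓝 0) :=
        Real.tendsto_exp_atBot.comp (tendsto_id.const_mul_atTop_of_neg (by linarith))
      simpa using (h1.const_mul A).mul_const (gapEnergy r (fun j => x j 0) (fun j => v j 0))
    have hz : ∀ f : ℝ → ℝ, (∀ t, f t ^ 2 ≤ gapEnergy r (fun j => x j t) (fun j => v j t)) →
        Tendsto f atTop (𝓝 0) := by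
      intro f hf
      have h2 : Tendsto (fun t => f t ^ 2) atTop (𝓝 0) := by
        refine squeeze_zero' (Eventually.of_forall fun t => sq_nonneg _) ?_ hb0
        filter_upwards [eventually_ge_atTop 0] with t ht using (hf t).trans (H N x v h t ht)
      rw [tendsto_zero_iff_abs_tendsto_zero]
      have h3 := h2.sqrt
      simpa [Real.sqrt_sq_eq_abs, Function.comp_def] using h3
    exact ⟨hz _ fun t => (sq_gaps_le_gapEnergy hr.le x v t i).1,
      hz _ fun t => (sq_gaps_le_gapEnergy hr.le x v t i).2⟩

/-! ### The uniform `L₂` gain -/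

lemma enorm_sq_eq_ofReal_sq (y : ℝ) : ‖y‖ₑ ^ 2 = ENNReal.ofReal (y ^ 2) := by
  rw [Real.enorm_eq_ofReal_abs, ← ENNReal.ofReal_pow (abs_nonneg y), sq_abs]

lemma aestronglyMeasurable_gaps {N : ℕ} {d : Fin (N + 1) → ℝ → ℝ}
    (hd : ∀ k, LocallyIntegrable (d k) volume) (i : Fin N) :
    AEStronglyMeasurable (gaps d i) volume :=
  (hd _).aestronglyMeasurable.sub (hd _).aestronglyMeasurable

/-- The weighted spacing errors have an `L₂` gain that does not depend on the size of the chain. -/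
theorem exists_weighted_gain {a b κ r : ℝ} (ha : 0 < a) (hb : 0 < b) (hκ : 0 < κ) (hr : 1 < r) :
    ∃ K : ℝ, 0 < K ∧ ∀ (N : ℕ) (d x v : Fin (N + 1) → ℝ → ℝ),
      IsTrajectory (PDGains.tuned a b κ (r ^ 2)) d x v →
      (∀ i, Tendsto (gaps x i) atBot (𝓝 0) ∧ Tendsto (gaps v i) atBot (𝓝 0)) →
      ∑ i : Fin N, ∫⁻ t, ‖r ^ ((i : ℕ) + 1) * gaps x i t‖ₑ ^ 2 ≤
        ENNReal.ofReal K * ∑ i : Fin N, ∫⁻ t, ‖r ^ ((i : ℕ) + 1) * gaps d i t‖ₑ ^ 2 := by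
  obtain ⟨m, L, c, K, hm, hL, hc, hK, H⟩ := exists_lyapunov_trajectory ha hb hκ hr
  refine ⟨K / c, by positivity, fun N d x v h hbot => ?_⟩
  obtain ⟨V, V', hac, hlo, hup, hder, hrate⟩ := H N _ x v h
  by_cases htop : ∑ i : Fin N, ∫⁻ t, ‖r ^ ((i : ℕ) + 1) * gaps d i t‖ₑ ^ 2 = ⊤
  · rw [htop, ENNReal.mul_top (ENNReal.ofReal_pos.2 (by positivity)).ne']
    exact le_top
  have hfin : ∀ i : Fin N, ∫⁻ t, ‖r ^ ((i : ℕ) + 1) * gaps d i t‖ₑ ^ 2 < ⊤ := fun i =>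
    (ENNReal.sum_ne_top.1 htop i (Finset.mem_univ i)).lt_top
  have hint : ∀ i : Fin N, Integrable (fun t => (r ^ ((i : ℕ) + 1) * gaps d i t) ^ 2) volume := by
    intro i
    refine ⟨((aestronglyMeasurable_gaps h.locallyIntegrable i).const_mul _).pow 2, ?_⟩
    simpa only [HasFiniteIntegral, enorm_pow] using hfin i
  obtain ⟨S, hS⟩ : ∃ S : ℝ → ℝ, S = fun t => ∑ i : Fin N, (r ^ ((i : ℕ) + 1) * gaps d i t) ^ 2 :=
    ⟨_, rfl⟩
  have hSint : Integrable S volume := by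
    rw [hS]; exact integrable_finsetSum _ fun i _ => hint i
  have hS0 : ∀ t, 0 ≤ S t := fun t => by
    rw [hS]; exact Finset.sum_nonneg fun _ _ => sq_nonneg _
  have hSeq : ENNReal.ofReal (∫ t, S t) =
      ∑ i : Fin N, ∫⁻ t, ‖r ^ ((i : ℕ) + 1) * gaps d i t‖ₑ ^ 2 := by
    rw [hS, integral_finsetSum _ fun i _ => hint i,
      ENNReal.ofReal_sum_of_nonneg fun i _ => integral_nonneg fun t => sq_nonneg _]
    refine Finset.sum_congr rfl fun i _ => ?_
    rw [ofReal_integral_eq_lintegral_ofReal (hint i) (Eventually.of_forall fun t => sq_nonneg _)]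
    simp only [enorm_sq_eq_ofReal_sq]
  obtain ⟨En, hEn⟩ : ∃ En : ℝ → ℝ, En = fun t => gapEnergy r (fun j => x j t) (fun j => v j t) :=
    ⟨_, rfl⟩
  have hEc : Continuous En := by rw [hEn]; exact h.continuous_gapEnergy r
  have hE0 : ∀ t, 0 ≤ En t := fun t => by rw [hEn]; exact gapEnergy_nonneg r _ _
  have hEbot : Tendsto En atBot (𝓝 0) := by rw [hEn]; exact tendsto_gapEnergy r hbot
  have hbound : ∀ s t, s ≤ t → ∫ τ in s..t, En τ ≤ K / c * ∫ τ, S τ := by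
    intro s t hst
    -- Integrate the dissipation inequality from a remote time `p`, dropping `V t ≥ 0`; the initial
    -- term `L * En p` then disappears as `p → -∞`, because responses start from equilibrium.
    have hev : ∀ᶠ p in atBot, c * ∫ τ in s..t, En τ ≤ L * En p + K * ∫ τ, S τ := by
      filter_upwards [eventually_le_atBot s] with p hp
      have h1 := (hac p t).sub_le_integral (hp.trans hst) hder
        (h := fun τ => -c * En τ + K * S τ)
        (Eventually.of_forall fun τ => by
          have := hrate τ
          simp only [Finset.sum_range, weightedGap_eq_gaps] at this
          simpa only [hEn, hS] using this)
        (((hEc.intervalIntegrable p t).const_mul _).add (hSint.intervalIntegrable.const_mul K))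
      rw [intervalIntegral.integral_add ((hEc.intervalIntegrable p t).const_mul _)
        (hSint.intervalIntegrable.const_mul K), intervalIntegral.integral_const_mul,
        intervalIntegral.integral_const_mul] at h1
      have h2 : ∫ τ in p..t, S τ ≤ ∫ τ, S τ := by
        rw [intervalIntegral.integral_of_le (hp.trans hst)]
        exact setIntegral_le_integral hSint (Eventually.of_forall hS0)
      have h3 : ∫ τ in s..t, En τ ≤ ∫ τ in p..t, En τ :=
        intervalIntegral.integral_mono_interval hp hst le_rfl
          (Eventually.of_forall hE0) (hEc.intervalIntegrable p t)
      have h4 : 0 ≤ V t := (mul_nonneg hm.le (gapEnergy_nonneg r _ _)).trans (hlo t)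
      have h5 : V p ≤ L * En p := by simpa only [hEn] using hup p
      have h6 := mul_le_mul_of_nonneg_left h2 hK.le
      have h7 := mul_le_mul_of_nonneg_left h3 hc.le
      linarith
    have hlim : Tendsto (fun p => L * En p + K * ∫ τ, S τ) atBot (𝓝 (K * ∫ τ, S τ)) := by
      simpa using (hEbot.const_mul L).add_const (K * ∫ τ, S τ)
    have h8 := ge_of_tendsto hlim hev
    rw [div_mul_eq_mul_div, le_div_iff₀ hc]
    linarith
  have hneg : Tendsto (fun n : ℕ => -(n : ℝ)) atTop atBot :=
    tendsto_neg_atTop_atBot.comp tendsto_natCast_atTop_atTop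
  have hpos : Tendsto (fun n : ℕ => (n : ℝ)) atTop atTop := tendsto_natCast_atTop_atTop
  have hle : ∀ n : ℕ, -(n : ℝ) ≤ n := fun n => by linarith [n.cast_nonneg (α := ℝ)]
  have hEint : Integrable En volume :=
    integrable_of_intervalIntegral_norm_bounded (K / c * ∫ τ, S τ)
      (fun n : ℕ => (hEc.integrableOn_Icc (a := -(n : ℝ)) (b := n)).mono_set Set.Ioc_subset_Icc_self)
      hneg hpos (Eventually.of_forall fun n => by
        simp only [Real.norm_of_nonneg (hE0 _)]
        exact hbound _ _ (hle n))
  have hEle : ∫ t, En t ≤ K / c * ∫ t, S t :=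
    le_of_tendsto (intervalIntegral_tendsto_integral hEint hneg hpos)
      (Eventually.of_forall fun n => hbound _ _ (hle n))
  have hmeas : ∀ i : Fin N, Measurable fun t => ‖r ^ ((i : ℕ) + 1) * gaps x i t‖ₑ ^ 2 := by
    intro i
    have hx := h.continuous_position
    have : Continuous fun t => r ^ ((i : ℕ) + 1) * gaps x i t := by
      simp only [gaps]; fun_prop
    exact this.measurable.enorm.pow_const 2
  calc ∑ i : Fin N, ∫⁻ t, ‖r ^ ((i : ℕ) + 1) * gaps x i t‖ₑ ^ 2
      = ∫⁻ t, ∑ i : Fin N, ‖r ^ ((i : ℕ) + 1) * gaps x i t‖ₑ ^ 2 :=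
        (lintegral_finsetSum _ fun i _ => hmeas i).symm
    _ ≤ ∫⁻ t, ENNReal.ofReal (En t) := by
        refine lintegral_mono fun t => ?_
        simp only [enorm_sq_eq_ofReal_sq]
        rw [← ENNReal.ofReal_sum_of_nonneg fun i _ => sq_nonneg _]
        refine ENNReal.ofReal_le_ofReal ?_
        rw [hEn]
        simp only [gapEnergy_eq]
        exact le_add_of_nonneg_right (Finset.sum_nonneg fun _ _ => sq_nonneg _)
    _ = ENNReal.ofReal (∫ t, En t) :=
        (ofReal_integral_eq_lintegral_ofReal hEint (Eventually.of_forall hE0)).symm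
    _ ≤ ENNReal.ofReal (K / c * ∫ t, S t) := ENNReal.ofReal_le_ofReal hEle
    _ = _ := by rw [ENNReal.ofReal_mul (by positivity), hSeq]

lemma eLpNorm_two_eq (f : ℝ → ℝ) :
    eLpNorm f 2 volume = (∫⁻ t, ‖f t‖ₑ ^ 2) ^ (1 / 2 : ℝ) := by
  rw [eLpNorm_eq_lintegral_rpow_enorm_toReal two_ne_zero ENNReal.ofNat_ne_top]
  simp

lemma sq_normL2l2 {ι : Type} [Fintype ι] (z : ι → ℝ → ℝ) :
    ∑ k, ∫⁻ t, ‖z k t‖ₑ ^ 2 = normL2l2 z ^ 2 := by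
  rw [normL2l2, ← ENNReal.rpow_natCast, ← ENNReal.rpow_mul]
  simp

lemma rpow_half_le_iff {p q : ℝ≥0∞} : p ^ (1 / 2 : ℝ) ≤ q ↔ p ≤ q ^ 2 := by
  rw [one_div, ENNReal.rpow_inv_le_iff (by norm_num)]
  norm_num

/-- Uniform gain from disturbances supported on the first vehicles to the spacing errors. -/
theorem exists_uniform_gain {a b κ r : ℝ} (ha : 0 < a) (hb : 0 < b) (hκ : 0 < κ) (hr : 1 < r)
    (kbar : ℕ) :
    ∃ C : ℝ≥0, ∀ (N : ℕ) (d : Fin (N + 1) → ℝ → ℝ) (e : Fin N → ℝ → ℝ),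
      SupportedOnFirst kbar (gaps d) → IsErrorResponse (PDGains.tuned a b κ (r ^ 2)) N d e →
        normL2l2 e ≤ C * normL2l2 (gaps d) ∧
          ∑ k, eLpNorm (e k) 2 volume ≤ C * normL2l2 (gaps d) := by
  obtain ⟨K, hK, H⟩ := exists_weighted_gain ha hb hκ hr
  have hr0 : 0 < r := by linarith
  obtain ⟨A, hA⟩ : ∃ A : ℝ≥0∞, A = ENNReal.ofReal (√K * r ^ kbar) := ⟨_, rfl⟩
  obtain ⟨q, hq⟩ : ∃ q : ℝ≥0∞, q = ENNReal.ofReal r⁻¹ := ⟨_, rfl⟩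
  have hq1 : q < 1 := by
    rw [hq]; exact ENNReal.ofReal_lt_one.2 (inv_lt_one_of_one_lt₀ hr)
  have hgeo : (1 - q)⁻¹ ≠ ⊤ := ENNReal.inv_ne_top.2 (tsub_pos_of_lt hq1).ne'
  -- Lets the constant of the summed bound serve for the `l₂` bound too.
  have hone : 1 ≤ (1 - q)⁻¹ := ENNReal.one_le_inv.2 tsub_le_self
  have hAtop : A ≠ ⊤ := by rw [hA]; exact ENNReal.ofReal_ne_top
  refine ⟨(((1 - q)⁻¹ * A).toNNReal), fun N d e hsupp ⟨x, v, h, he, hbot⟩ => ?_⟩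
  rw [ENNReal.coe_toNNReal (ENNReal.mul_ne_top hgeo hAtop)]
  have hmain : ∑ i : Fin N, ∫⁻ t, ‖r ^ ((i : ℕ) + 1) * gaps x i t‖ₑ ^ 2 ≤
      (A * normL2l2 (gaps d)) ^ 2 := by
    refine (H N d x v h hbot).trans ?_
    rw [mul_pow, ← sq_normL2l2, hA, ← ENNReal.ofReal_pow (by positivity), mul_pow,
      Real.sq_sqrt hK.le, ENNReal.ofReal_mul hK.le, mul_assoc]
    refine mul_le_mul_right ?_ _
    rw [Finset.mul_sum]
    refine Finset.sum_le_sum fun i _ => ?_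
    -- The only use of the support condition: beyond `kbar` the growing weights multiply zero, up to
    -- `kbar` they are at most `r ^ kbar`.
    by_cases hi : kbar < (i : ℕ) + 1
    · have h0 : ∫⁻ t, ‖r ^ ((i : ℕ) + 1) * gaps d i t‖ₑ ^ 2 = ∫⁻ _ : ℝ, 0 := by
        refine lintegral_congr_ae ?_
        filter_upwards [hsupp i hi] with t ht
        simp [ht]
      rw [h0, lintegral_zero]
      exact zero_le
    · rw [← lintegral_const_mul' _ _ ENNReal.ofReal_ne_top]
      refine lintegral_mono fun t => ?_
      rw [enorm_mul, mul_pow, enorm_sq_eq_ofReal_sq]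
      gcongr
      · exact hr.le
      · omega
  subst he
  have hweight : ∀ i : Fin N, (1 : ℝ≥0∞) ≤ ‖r ^ ((i : ℕ) + 1)‖ₑ := fun i => by
    rw [Real.enorm_eq_ofReal (by positivity)]
    exact ENNReal.one_le_ofReal.2 (one_le_pow₀ hr.le)
  constructor
  · rw [normL2l2, rpow_half_le_iff]
    refine le_trans (Finset.sum_le_sum fun i _ => lintegral_mono fun t => ?_) (hmain.trans ?_)
    · rw [enorm_mul]
      gcongr
      exact le_mul_of_one_le_left' (hweight i)
    · gcongr
      exact le_mul_of_one_le_left' hone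
  · have hterm : ∀ i : Fin N, eLpNorm (gaps x i) 2 volume ≤
        q ^ (i : ℕ) * (A * normL2l2 (gaps d)) := by
      intro i
      have h1 : eLpNorm (fun t => r ^ ((i : ℕ) + 1) * gaps x i t) 2 volume ≤
          A * normL2l2 (gaps d) := by
        rw [eLpNorm_two_eq, rpow_half_le_iff]
        exact (Finset.single_le_sum (f := fun i : Fin N =>
          ∫⁻ t, ‖r ^ ((i : ℕ) + 1) * gaps x i t‖ₑ ^ 2) (fun _ _ => zero_le)
          (Finset.mem_univ i)).trans hmain
      have h2 : gaps x i = (r⁻¹ ^ ((i : ℕ) + 1)) • fun t => r ^ ((i : ℕ) + 1) * gaps x i t := by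
        funext t
        simp only [Pi.smul_apply, smul_eq_mul]
        rw [← mul_assoc, ← mul_pow, inv_mul_cancel₀ hr0.ne', one_pow, one_mul]
      rw [h2, eLpNorm_const_smul, Real.enorm_eq_ofReal (by positivity),
        ENNReal.ofReal_pow (by positivity), ← hq]
      refine mul_le_mul' ?_ h1
      -- One factor `q` is given away so that the bounds sum to the full geometric series from
      -- exponent `0`.
      exact pow_le_pow_right_of_le_one' hq1.le (Nat.le_succ _)
    refine (Finset.sum_le_sum fun i _ => hterm i).trans ?_
    rw [← Finset.sum_mul, mul_assoc]
    refine mul_le_mul_left ?_ _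
    rw [← ENNReal.tsum_geometric, ← Finset.sum_range (fun i => q ^ i)]
    exact ENNReal.sum_le_tsum _

/-! ### From gains to string stability -/

/-- Use `(y - z) ^ 2 ≤ 2 y ^ 2 + 2 z ^ 2`; each vehicle belongs to at most two gaps, so the squared
norm grows by at most `4`. -/
lemma normL2l2_gaps_le {N : ℕ} {d : Fin (N + 1) → ℝ → ℝ}
    (hd : ∀ k, LocallyIntegrable (d k) volume) : normL2l2 (gaps d) ≤ 2 * normL2l2 d := by
  have hm : ∀ k, AEMeasurable (fun t => ‖d k t‖ₑ ^ 2) volume := fun k =>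
    (hd k).aestronglyMeasurable.enorm.pow_const 2
  rw [normL2l2, rpow_half_le_iff, mul_pow, ← sq_normL2l2]
  have hterm : ∀ i : Fin N, ∫⁻ t, ‖gaps d i t‖ₑ ^ 2 ≤
      2 * (∫⁻ t, ‖d i.castSucc t‖ₑ ^ 2) + 2 * ∫⁻ t, ‖d i.succ t‖ₑ ^ 2 := by
    intro i
    rw [← lintegral_const_mul'' _ (hm _), ← lintegral_const_mul'' _ (hm _),
      ← lintegral_add_left' ((hm _).const_mul _)]
    refine lintegral_mono fun t => ?_
    simp only [enorm_sq_eq_ofReal_sq]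
    rw [show (2 : ℝ≥0∞) = ENNReal.ofReal 2 by simp, ← ENNReal.ofReal_mul (by norm_num),
      ← ENNReal.ofReal_mul (by norm_num), ← ENNReal.ofReal_add (by positivity) (by positivity)]
    refine ENNReal.ofReal_le_ofReal ?_
    rw [gaps]
    nlinarith [sq_nonneg (d i.castSucc t + d i.succ t)]
  have h1 : ∑ i : Fin N, ∫⁻ t, ‖d i.castSucc t‖ₑ ^ 2 ≤ ∑ k, ∫⁻ t, ‖d k t‖ₑ ^ 2 := by
    rw [Fin.sum_univ_castSucc]; exact le_self_add
  have h2 : ∑ i : Fin N, ∫⁻ t, ‖d i.succ t‖ₑ ^ 2 ≤ ∑ k, ∫⁻ t, ‖d k t‖ₑ ^ 2 := by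
    rw [Fin.sum_univ_succ]; exact le_add_self
  calc ∑ i : Fin N, ∫⁻ t, ‖gaps d i t‖ₑ ^ 2
      ≤ ∑ i : Fin N, (2 * (∫⁻ t, ‖d i.castSucc t‖ₑ ^ 2) + 2 * ∫⁻ t, ‖d i.succ t‖ₑ ^ 2) :=
        Finset.sum_le_sum fun i _ => hterm i
    _ ≤ 2 * (∑ k, ∫⁻ t, ‖d k t‖ₑ ^ 2) + 2 * ∑ k, ∫⁻ t, ‖d k t‖ₑ ^ 2 := by
        rw [Finset.sum_add_distrib, ← Finset.mul_sum, ← Finset.mul_sum]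
        gcongr
    _ = 2 ^ 2 * ∑ k, ∫⁻ t, ‖d k t‖ₑ ^ 2 := by ring

lemma stringStable_of_le {ι : ℕ → Type} [∀ N, Fintype (ι N)]
    {R : ∀ N, (ι N → ℝ → ℝ) → (Fin N → ℝ → ℝ) → Prop} (C : ℝ≥0)
    (h : ∀ N w e, R N w e → normL2l2 e ≤ C * normL2l2 w) : StringStable R := by
  intro ε hε
  -- `C + 1` in place of `C` covers `C = 0` and keeps the final inequality strict.
  refine ⟨ε / (C + 1), by positivity, fun N _ w e hR hw => ?_⟩
  have hC : ((C : ℝ≥0∞) + 1) = ENNReal.ofReal (C + 1) := by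
    rw [ENNReal.ofReal_add C.coe_nonneg zero_le_one]; simp
  calc normL2l2 e ≤ C * normL2l2 w := h N w e hR
    _ ≤ (C + 1) * normL2l2 w := mul_le_mul_left le_self_add _
    _ < (C + 1) * ENNReal.ofReal (ε / (C + 1)) :=
        ENNReal.mul_lt_mul_right (by simp) (by simp) hw
    _ = ENNReal.ofReal ε := by
        rw [hC, ← ENNReal.ofReal_mul (by positivity)]
        congr 1
        field_simp

theorem theorem3 (a b κ : ℝ) (ha : 0 < a) (hb : 0 < b) (hκ : 0 < κ) :
    ∃ αbar : ℝ, 1 ≤ αbar ∧ ∀ α : ℝ, αbar < α →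
      (∀ N : ℕ, 1 ≤ N → AsymptoticallyStable (PDGains.tuned a b κ α) N) ∧
      ∀ kbar : ℕ,
        StringStable (ι := fun N => Fin (N + 1)) (fun N d e =>
          SupportedOnFirst kbar (gaps d) ∧ IsErrorResponse (PDGains.tuned a b κ α) N d e) ∧
        StringStable (ι := fun N => Fin N) (fun N d' e =>
          SupportedOnFirst kbar d' ∧
            ∃ d, gaps d = d' ∧ IsErrorResponse (PDGains.tuned a b κ α) N d e) ∧
        ∃ C : ℝ≥0, ∀ N : ℕ, 1 ≤ N →
          ∀ (d : Fin (N + 1) → ℝ → ℝ) (e : Fin N → ℝ → ℝ),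
            SupportedOnFirst kbar (gaps d) →
            IsErrorResponse (PDGains.tuned a b κ α) N d e →
              normL2l2 e ≤ C * normL2l2 (gaps d) ∧
              ∑ k, eLpNorm (e k) 2 volume ≤ C * normL2l2 (gaps d) := by
  refine ⟨1, le_rfl, fun α hα => ?_⟩
  obtain ⟨r, hr, rfl⟩ : ∃ r : ℝ, 1 < r ∧ r ^ 2 = α :=
    ⟨√α, Real.lt_sqrt_of_sq_lt (by simpa using hα), Real.sq_sqrt (by linarith)⟩
  refine ⟨fun N _ => asymptoticallyStable_tuned ha hb hκ hr N, fun kbar => ?_⟩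
  obtain ⟨C, hC⟩ := exists_uniform_gain ha hb hκ hr kbar
  refine ⟨stringStable_of_le (C * 2) ?_, stringStable_of_le C ?_, C, fun N _ => hC N⟩
  · rintro N d e ⟨hs, hresp⟩
    have hd := hresp
    obtain ⟨x, v, h, -⟩ := hd
    refine ((hC N d e hs hresp).1).trans ?_
    rw [ENNReal.coe_mul, mul_assoc]
    exact mul_le_mul_right (normL2l2_gaps_le h.locallyIntegrable) _
  · rintro N _ e ⟨hs, d, rfl, hresp⟩
    exact (hC N d e hs hresp).1
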